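/- Let $q\ge 1$. For $d\ge 1$ let $\Psi=(\psi_{jk})_{j,k=1}^d$ be a Haar-distributed random unitary $d\times d$ matrix, and for indices $j_r,k_r,j_r',k_r'\in\{1,\dots,d\}$, $1\le r\le q$, consider the monomial \[ \psi_G=\psi_{j_1k_1}\cdots\psi_{j_qk_q}\,\overline{\psi_{j_1'k_1'}}\cdots\overline{\psi_{j_q'k_q'}} . \] Its Weingarten graph $G$ is the bipartite directed multigraph with one black vertex for each distinct element of $\{j_1,\dots,j_q,j_1',\dots,j_q'\}$, one white vertex for each distinct element of $\{k_1,\dots,k_q,k_1',\dots,k_q'\}$, and $2q$ edges: for each $r$, one edge from the black vertex $j_r$ to the white vertex $k_r$ and one edge from the white vertex $k_r'$ to the black vertex $j_r'$. Let $V$ be the number of vertices of $G$ and $c$ the number of its connected components (ignoring the directions of the edges). Then \[ \mathbb E[\psi_G]=O_q\left(d^{-q}\right)\qquad\text{and}\qquad \mathbb E[\psi_G]=O_q\left(d^{\,c-V}\right), \] that is, there is a constant $C_q$, depending only on $q$, such that for all $d\ge 1$ and all choices of indices, $|\mathbb E[\psi_G]|\le C_q\,d^{-q}$ and $|\mathbb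 E[\psi_G]|\le C_q\,d^{\,c-V}$. -/

import Mathlib

open MeasureTheory

/-- A directed multigraph with vertex type `V` and edge type `E`. -/
structure DiMultigraph (V E : Type) where
  src : E → V
  tgt : E → V

namespace DiMultigraph

variable {V E : Type}

/-- The simple graph obtained by forgetting directions, multiplicities (and loops). -/
def underlying (G : DiMultigraph V E) : SimpleGraph V :=
  SimpleGraph.fromRel fun u v => ∃ e : E, G.src e = u ∧ G.tgt e = v

/-- The number of vertices. -/
noncomputable def numVertices (_G : DiMultigraph V E) : ℕ := Nat.card V

/-- The number of edges, counted with multiplicity. -/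
noncomputable def numEdges (_G : DiMultigraph V E) : ℕ := Nat.card E

/-- The number of connected components (directions are ignored). -/
noncomputable def numComponents (G : DiMultigraph V E) : ℕ :=
  Nat.card G.underlying.ConnectedComponent

end DiMultigraph

/-- The index data of a monomial
`ψ_{j₁k₁} ⋯ ψ_{j_q k_q} · conj ψ_{j'₁k'₁} ⋯ conj ψ_{j'_q k'_q}`
in the entries of a `d × d` matrix. -/
structure MonomialIndices (q d : ℕ) where
  j : Fin q → Fin d
  k : Fin q → Fin d
  j' : Fin q → Fin d
  k' : Fin q → Fin d

namespace MonomialIndices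

variable {q d : ℕ}

/-- The vertices: one black vertex `Sum.inl a` for each distinct row index `a` that occurs and one
white vertex `Sum.inr b` for each distinct column index `b` that occurs. -/
def vertexSet (m : MonomialIndices q d) : Set (Fin d ⊕ Fin d) :=
  Sum.inl '' (Set.range m.j ∪ Set.range m.j') ∪ Sum.inr '' (Set.range m.k ∪ Set.range m.k')

/-- The black vertex of a row index that occurs. -/
def black (m : MonomialIndices q d) (a : Fin d) (ha : a ∈ Set.range m.j ∪ Set.range m.j') :
    m.vertexSet :=
  ⟨Sum.inl a, Or.inl ⟨a, ha, rfl⟩⟩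

/-- The white vertex of a column index that occurs. -/
def white (m : MonomialIndices q d) (b : Fin d) (hb : b ∈ Set.range m.k ∪ Set.range m.k') :
    m.vertexSet :=
  ⟨Sum.inr b, Or.inr ⟨b, hb, rfl⟩⟩

/-- The Weingarten graph. The edge `Sum.inl r`, for the factor `ψ_{j_r k_r}`, goes from the black
vertex `j_r` to the white vertex `k_r`; the edge `Sum.inr r`, for the factor `conj ψ_{j'_r k'_r}`,
goes from the white vertex `k'_r` to the black vertex `j'_r`. -/
def weingartenGraph (m : MonomialIndices q d) : DiMultigraph m.vertexSet (Fin q ⊕ Fin q) where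
  src := Sum.elim (fun r => m.black (m.j r) (Or.inl ⟨r, rfl⟩))
    (fun r => m.white (m.k' r) (Or.inr ⟨r, rfl⟩))
  tgt := Sum.elim (fun r => m.white (m.k r) (Or.inl ⟨r, rfl⟩))
    (fun r => m.black (m.j' r) (Or.inr ⟨r, rfl⟩))

/-- The monomial `ψ_G` evaluated at a unitary matrix `U`. -/
noncomputable def psi (m : MonomialIndices q d) (U : Matrix.unitaryGroup (Fin d) ℂ) : ℂ :=
  (∏ r, (U : Matrix (Fin d) (Fin d) ℂ) (m.j r) (m.k r)) *
    ∏ r, star ((U : Matrix (Fin d) (Fin d) ℂ) (m.j' r) (m.k' r))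

theorem numEdges_weingartenGraph (m : MonomialIndices q d) :
    m.weingartenGraph.numEdges = 2 * q := by
  simp [DiMultigraph.numEdges, two_mul]

end MonomialIndices

instance unitaryGroup_compactSpace (d : ℕ) : CompactSpace (Matrix.unitaryGroup (Fin d) ℂ) := by
  apply isCompact_iff_compactSpace.mp
  have hK : IsCompact (Set.pi Set.univ fun _ : Fin d => Set.pi Set.univ fun _ : Fin d =>
      Metric.closedBall (0 : ℂ) 1) :=
    isCompact_univ_pi fun _ => isCompact_univ_pi fun _ => isCompact_closedBall _ _
  have hc : IsClosed ((Matrix.unitaryGroup (Fin d) ℂ : Set (Matrix (Fin d) (Fin d) ℂ))) := by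
    have : (Matrix.unitaryGroup (Fin d) ℂ : Set (Matrix (Fin d) (Fin d) ℂ)) =
        {A | A * star A = 1} := by
      ext A
      exact Matrix.mem_unitaryGroup_iff
    rw [this]
    exact isClosed_eq (by fun_prop) (by fun_prop)
  refine hK.of_isClosed_subset hc fun A hA a _ b _ => ?_
  simpa using entry_norm_bound_of_unitary hA a b

noncomputable instance unitaryGroup_measurableSpace (d : ℕ) :
    MeasurableSpace (Matrix.unitaryGroup (Fin d) ℂ) := borel _

instance unitaryGroup_borelSpace (d : ℕ) : BorelSpace (Matrix.unitaryGroup (Fin d) ℂ) := ⟨rfl⟩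

/-- The Haar probability measure on the unitary group of `d × d` matrices. -/
noncomputable def haarUnitary (d : ℕ) : Measure (Matrix.unitaryGroup (Fin d) ℂ) :=
  Measure.haarMeasure ⊤

theorem haarUnitary_isProbabilityMeasure (d : ℕ) : IsProbabilityMeasure (haarUnitary d) :=
  ⟨Measure.haarMeasure_self⟩

theorem haarUnitary_isHaarMeasure (d : ℕ) : (haarUnitary d).IsHaarMeasure :=
  Measure.isHaarMeasure_haarMeasure _

/-- The expectation of `ψ_G` for a Haar-distributed unitary matrix. -/
noncomputable def MonomialIndices.expectation {q d : ℕ} (m : MonomialIndices q d) : ℂ :=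
  ∫ U, m.psi U ∂(haarUnitary d)

/-! Left invariance of Haar measure, differentiated along one-parameter groups, gives linear
relations between expectations of monomials (`sum_updateRow_eq_sum_updateRow'`). Summing these over
a row index and using orthonormality of columns yields `natCast_mul_expectation_add_sum_swapRow`:
`d` times an expectation, plus `q` expectations of the same degree `q + 1` with two conjugated row
indices exchanged, equals a sum of at most `q + 1` expectations of degree `q`.

For `d ≥ 2 * (q + 1)`, take a monomial of largest expectation: the exchanged terms are absorbed into
the left side, and each degree gains a factor `1 / d`. For the second bound, expectations are
weighted by a power of `d / (2 * (q + 1))` with exponent the rank of the incidence matrix. An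
exchange or a removal lowers this rank by at most one, so one factor of `d` pays for it. Since `V ≤
c + rank`, this suffices. Small `d` is covered by `|ψ_G| ≤ 1`. -/

instance haarUnitary.instIsProbabilityMeasure (d : ℕ) : IsProbabilityMeasure (haarUnitary d) :=
  haarUnitary_isProbabilityMeasure d

instance haarUnitary.instIsHaarMeasure (d : ℕ) : (haarUnitary d).IsHaarMeasure :=
  haarUnitary_isHaarMeasure d

/-! ### The invariance equation for monomials -/

/-- The product rule, for a product of entries `g r (j r)` that depend on an index each. -/
theorem sum_prod_erase_mul_sum_eq {ι κ R : Type*} [Fintype ι] [DecidableEq ι] [Fintype κ]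
    [CommSemiring R] (g : ι → κ → R) (j : ι → κ) (c : ι → κ → R) :
    ∑ i, (∏ r ∈ Finset.univ.erase i, g r (j r)) * ∑ l, c i l * g i l =
      ∑ i, ∑ l, c i l * ∏ r, g r (Function.update j i l r) := by
  refine Finset.sum_congr rfl fun i _ => ?_
  rw [Finset.mul_sum]
  refine Finset.sum_congr rfl fun l _ => ?_
  have h : ∏ r ∈ Finset.univ.erase i, g r (Function.update j i l r) =
      ∏ r ∈ Finset.univ.erase i, g r (j r) := Finset.prod_congr rfl fun r hr => by
    rw [Function.update_of_ne (Finset.ne_of_mem_erase hr)]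
  rw [← Finset.mul_prod_erase Finset.univ (fun r => g r (Function.update j i l r))
    (Finset.mem_univ i), Function.update_self, h]
  ring

namespace MonomialIndices

variable {q d : ℕ}

theorem continuous_psi (m : MonomialIndices q d) : Continuous m.psi := by
  unfold psi
  have h : ∀ a b, Continuous fun U : Matrix.unitaryGroup (Fin d) ℂ =>
      (U : Matrix (Fin d) (Fin d) ℂ) a b := fun a b => continuous_subtype_val.matrix_elem a b
  exact (continuous_finsetProd _ fun r _ => h _ _).mul
    (continuous_finsetProd _ fun r _ => (h _ _).star)

theorem integrable_of_continuous {f : Matrix.unitaryGroup (Fin d) ℂ → ℂ} (hf : Continuous f) :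
    Integrable f (haarUnitary d) :=
  hf.integrable_of_hasCompactSupport (HasCompactSupport.of_compactSpace f)

theorem integrable_psi (m : MonomialIndices q d) : Integrable m.psi (haarUnitary d) :=
  integrable_of_continuous m.continuous_psi

theorem norm_psi_le_one (m : MonomialIndices q d) (U : Matrix.unitaryGroup (Fin d) ℂ) :
    ‖m.psi U‖ ≤ 1 := by
  rw [psi, norm_mul, norm_prod, norm_prod]
  refine mul_le_one₀ (Finset.prod_le_one (fun _ _ => norm_nonneg _) fun r _ =>
    entry_norm_bound_of_unitary U.2 _ _) (Finset.prod_nonneg fun _ _ => norm_nonneg _)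
    (Finset.prod_le_one (fun _ _ => norm_nonneg _) fun r _ => ?_)
  rw [norm_star]
  exact entry_norm_bound_of_unitary U.2 _ _

theorem norm_expectation_le_one (m : MonomialIndices q d) : ‖m.expectation‖ ≤ 1 := by
  have := norm_integral_le_of_norm_le_const (μ := haarUnitary d)
    (Filter.Eventually.of_forall m.norm_psi_le_one)
  simpa [expectation] using this

/-- The monomial with the row index of its `r`-th factor replaced by `l`. -/
def updateRow (m : MonomialIndices q d) (r : Fin q) (l : Fin d) : MonomialIndices q d :=
  { m with j := Function.update m.j r l }

/-- The monomial with the row index of its `r`-th conjugated factor replaced by `l`. -/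
def updateRow' (m : MonomialIndices q d) (r : Fin q) (l : Fin d) : MonomialIndices q d :=
  { m with j' := Function.update m.j' r l }

/-- The derivative of `ψ_G` along the left-translation flow of a skew-Hermitian matrix `X`,
written so that it is linear in `X`. -/
noncomputable def variation (m : MonomialIndices q d) (X : Matrix (Fin d) (Fin d) ℂ)
    (U : Matrix.unitaryGroup (Fin d) ℂ) : ℂ :=
  ∑ r, ∑ l, X (m.j r) l * (m.updateRow r l).psi U -
    ∑ r, ∑ l, X l (m.j' r) * (m.updateRow' r l).psi U

theorem continuous_variation (m : MonomialIndices q d) (X : Matrix (Fin d) (Fin d) ℂ) :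
    Continuous (m.variation X) := by
  unfold variation
  exact (continuous_finsetSum _ fun r _ => continuous_finsetSum _ fun l _ =>
      continuous_const.mul (continuous_psi _)).sub
    (continuous_finsetSum _ fun r _ => continuous_finsetSum _ fun l _ =>
      continuous_const.mul (continuous_psi _))

/-- The one-parameter group of unitary matrices generated by a skew-Hermitian matrix. -/
noncomputable def unitaryFlow {X : Matrix (Fin d) (Fin d) ℂ}
    (hX : X ∈ skewAdjoint (Matrix (Fin d) (Fin d) ℂ)) (t : ℝ) : Matrix.unitaryGroup (Fin d) ℂ :=
  ⟨NormedSpace.exp (t • X), by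
    have h : (t • X).conjTranspose = -(t • X) := skewAdjoint.mem_iff.mp (skewAdjoint.smul_mem t hX)
    rw [Matrix.mem_unitaryGroup_iff', Matrix.star_eq_conjTranspose, ← Matrix.exp_conjTranspose, h,
      ← Matrix.exp_add_of_commute (-(t • X)) (t • X) (Commute.refl (t • X)).neg_left, neg_add_cancel,
      NormedSpace.exp_zero]⟩

theorem unitaryFlow_zero {X : Matrix (Fin d) (Fin d) ℂ}
    (hX : X ∈ skewAdjoint (Matrix (Fin d) (Fin d) ℂ)) : unitaryFlow hX 0 = 1 := by
  ext1
  simp [unitaryFlow]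

open scoped Matrix.Norms.Operator in
theorem hasDerivAt_unitaryFlow_apply {X : Matrix (Fin d) (Fin d) ℂ}
    (hX : X ∈ skewAdjoint (Matrix (Fin d) (Fin d) ℂ)) (t : ℝ) (a b : Fin d) :
    HasDerivAt (fun s => (unitaryFlow hX s : Matrix (Fin d) (Fin d) ℂ) a b)
      ((X * (unitaryFlow hX t : Matrix (Fin d) (Fin d) ℂ)) a b) t := by
  have h : HasDerivAt (fun s : ℝ => NormedSpace.exp (s • X)) (X * NormedSpace.exp (t • X)) t :=
    hasDerivAt_exp_smul_const' X t
  let L : Matrix (Fin d) (Fin d) ℂ →L[ℝ] ℂ :=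
    LinearMap.toContinuousLinearMap (Matrix.entryLinearMap ℝ ℂ a b)
  exact L.hasFDerivAt.comp_hasDerivAt t h

theorem hasDerivAt_unitaryFlow_mul_apply {X : Matrix (Fin d) (Fin d) ℂ}
    (hX : X ∈ skewAdjoint (Matrix (Fin d) (Fin d) ℂ)) (U : Matrix.unitaryGroup (Fin d) ℂ) (t : ℝ)
    (a b : Fin d) :
    HasDerivAt (fun s => ((unitaryFlow hX s * U : Matrix.unitaryGroup (Fin d) ℂ) :
        Matrix (Fin d) (Fin d) ℂ) a b)
      (∑ l, X a l * ((unitaryFlow hX t * U : Matrix.unitaryGroup (Fin d) ℂ) :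
        Matrix (Fin d) (Fin d) ℂ) l b) t := by
  have h := HasDerivAt.fun_sum (u := Finset.univ) fun l _ =>
    (hasDerivAt_unitaryFlow_apply hX t a l).mul_const ((U : Matrix (Fin d) (Fin d) ℂ) l b)
  refine HasDerivAt.congr_deriv h ?_
  rw [← Matrix.mul_apply, Matrix.mul_assoc]
  rfl

theorem hasDerivAt_psi_unitaryFlow (m : MonomialIndices q d) {X : Matrix (Fin d) (Fin d) ℂ}
    (hX : X ∈ skewAdjoint (Matrix (Fin d) (Fin d) ℂ)) (U : Matrix.unitaryGroup (Fin d) ℂ) (t : ℝ) :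
    HasDerivAt (fun s => m.psi (unitaryFlow hX s * U)) (m.variation X (unitaryFlow hX t * U)) t := by
  set W := unitaryFlow hX t * U with hW
  have hstar : ∀ a b, -star (X a b) = X b a := fun a b => by
    have h : star X b a = (-X) b a := by rw [skewAdjoint.mem_iff.mp hX]
    rw [Matrix.star_apply, Matrix.neg_apply] at h
    rw [h, neg_neg]
  have h1 := HasDerivAt.fun_finsetProd (u := Finset.univ) fun r _ =>
    hasDerivAt_unitaryFlow_mul_apply hX U t (m.j r) (m.k r)
  have h2 := HasDerivAt.fun_finsetProd (u := Finset.univ) fun r _ =>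
    (hasDerivAt_unitaryFlow_mul_apply hX U t (m.j' r) (m.k' r)).star
  simp only [smul_eq_mul, ← hW] at h1 h2
  have e1 := sum_prod_erase_mul_sum_eq (fun r a => (W : Matrix (Fin d) (Fin d) ℂ) a (m.k r)) m.j
    (fun r l => X (m.j r) l)
  have e2 := sum_prod_erase_mul_sum_eq
    (fun r a => star ((W : Matrix (Fin d) (Fin d) ℂ) a (m.k' r))) m.j' (fun r l => -X l (m.j' r))
  have h := h1.mul h2
  refine HasDerivAt.congr_deriv h ?_
  simp only [star_sum, star_mul']
  simp only [← hstar (m.j' _) _, neg_neg] at e2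
  rw [e1, e2]
  simp only [← hW, variation, updateRow, updateRow', psi, Finset.sum_mul, Finset.mul_sum]
  simp only [← hstar (m.j' _) _, neg_mul, Finset.sum_neg_distrib, sub_neg_eq_add]
  congr 1 <;> refine Finset.sum_congr rfl fun r _ => Finset.sum_congr rfl fun l _ => ?_
  · ring
  · ring

/-- By left invariance the integral of `ψ_G (exp (t X) U)` does not depend on `t`; differentiate
under the integral at `t = 0`. -/
theorem integral_variation_of_skewAdjoint (m : MonomialIndices q d)
    {X : Matrix (Fin d) (Fin d) ℂ} (hX : X ∈ skewAdjoint (Matrix (Fin d) (Fin d) ℂ)) :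
    ∫ U, m.variation X U ∂(haarUnitary d) = 0 := by
  obtain ⟨C, hC⟩ := isCompact_univ.exists_bound_of_continuousOn
    (m.continuous_variation X).continuousOn
  have h := (hasDerivAt_integral_of_dominated_loc_of_deriv_le (μ := haarUnitary d) (x₀ := (0 : ℝ))
    (F := fun t U => m.psi (unitaryFlow hX t * U))
    (F' := fun t U => m.variation X (unitaryFlow hX t * U)) (bound := fun _ => C) Filter.univ_mem
    (Filter.Eventually.of_forall fun t =>
      (m.continuous_psi.comp (continuous_const_mul _)).aestronglyMeasurable)
    (integrable_of_continuous (m.continuous_psi.comp (continuous_const_mul _)))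
    ((m.continuous_variation X).comp (continuous_const_mul _)).aestronglyMeasurable
    (Filter.Eventually.of_forall fun U t _ => hC _ (Set.mem_univ _)) (integrable_const C)
    (Filter.Eventually.of_forall fun U t _ => m.hasDerivAt_psi_unitaryFlow hX U t)).2
  simp only [integral_mul_left_eq_self (μ := haarUnitary d) m.psi, unitaryFlow_zero,
    one_mul] at h
  exact h.unique (hasDerivAt_const _ _)

theorem integral_variation_eq (m : MonomialIndices q d) (X : Matrix (Fin d) (Fin d) ℂ) :
    ∫ U, m.variation X U ∂(haarUnitary d) =
      ∑ r, ∑ l, X (m.j r) l * (m.updateRow r l).expectation -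
        ∑ r, ∑ l, X l (m.j' r) * (m.updateRow' r l).expectation := by
  have hi : ∀ (c : ℂ) (m : MonomialIndices q d),
      Integrable (fun U => c * m.psi U) (haarUnitary d) := fun c m => m.integrable_psi.const_mul c
  simp only [variation]
  rw [integral_sub (integrable_finsetSum _ fun r _ => integrable_finsetSum _ fun l _ => hi _ _)
    (integrable_finsetSum _ fun r _ => integrable_finsetSum _ fun l _ => hi _ _),
    integral_finsetSum _ (fun r _ => integrable_finsetSum _ fun l _ => hi _ _),
    integral_finsetSum _ (fun r _ => integrable_finsetSum _ fun l _ => hi _ _)]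
  simp only [integral_finsetSum _ (fun l _ => hi _ _), integral_const_mul, expectation]

/-- Both sides are complex linear in `X`, and skew-Hermitian matrices span all matrices over `ℂ`, so
matrix units become admissible. -/
theorem expectation_variation (m : MonomialIndices q d) (X : Matrix (Fin d) (Fin d) ℂ) :
    ∑ r, ∑ l, X (m.j r) l * (m.updateRow r l).expectation =
      ∑ r, ∑ l, X l (m.j' r) * (m.updateRow' r l).expectation := by
  have key : ∀ Y ∈ skewAdjoint (Matrix (Fin d) (Fin d) ℂ),
      ∑ r, ∑ l, Y (m.j r) l * (m.updateRow r l).expectation =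
        ∑ r, ∑ l, Y l (m.j' r) * (m.updateRow' r l).expectation := fun Y hY => by
    rw [← sub_eq_zero, ← integral_variation_eq]
    exact m.integral_variation_of_skewAdjoint hY
  have h1 : X - star X ∈ skewAdjoint (Matrix (Fin d) (Fin d) ℂ) := by
    rw [skewAdjoint.mem_iff, star_sub, star_star, neg_sub]
  have h2 : Complex.I • (X + star X) ∈ skewAdjoint (Matrix (Fin d) (Fin d) ℂ) := by
    rw [skewAdjoint.mem_iff, star_smul, star_add, star_star, add_comm (star X)]
    simp [add_comm]
  have hX : X = (1 / 2 : ℂ) • (X - star X) +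
      (-Complex.I / 2) • (Complex.I • (X + star X)) := by
    rw [smul_smul, show -Complex.I / 2 * Complex.I = 1 / 2 by
      linear_combination (-1 / 2 : ℂ) * Complex.I_mul_I, ← smul_add]
    rw [show X - star X + (X + star X) = (2 : ℂ) • X by rw [two_smul]; abel, smul_smul]
    norm_num
  generalize X - star X = A at *
  generalize Complex.I • (X + star X) = B at *
  subst hX
  simp only [Matrix.add_apply, Matrix.smul_apply, smul_eq_mul, add_mul, Finset.sum_add_distrib,
    mul_assoc, ← Finset.mul_sum, key A h1, key B h2]

/-- Infinitesimal invariance under the matrix unit at `(a, b)`. -/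
theorem sum_updateRow_eq_sum_updateRow' (m : MonomialIndices q d) (a b : Fin d) :
    ∑ r with m.j r = a, (m.updateRow r b).expectation =
      ∑ r with m.j' r = b, (m.updateRow' r a).expectation := by
  have h := m.expectation_variation (Matrix.single a b 1)
  simp only [Matrix.single_apply, ite_mul, one_mul, zero_mul, ite_and] at h
  simpa [Finset.sum_filter, eq_comm, Finset.sum_ite_irrel] using h

end MonomialIndices

namespace MonomialIndices

variable {q d : ℕ}

/-! ### The recursion for the expectations -/

/-- The monomial in which the row indices of the conjugated factors `0` and `s` are exchanged. -/
def swapRow (m : MonomialIndices (q + 1) d) (s : Fin (q + 1)) : MonomialIndices (q + 1) d :=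
  { m with j' := m.j' ∘ Equiv.swap 0 s }

/-- The monomial without its `r`-th factor and its conjugated factor `0`. -/
def remove (m : MonomialIndices (q + 1) d) (r : Fin (q + 1)) : MonomialIndices q d :=
  ⟨m.j ∘ r.succAbove, m.k ∘ r.succAbove, m.j' ∘ Fin.succ, m.k' ∘ Fin.succ⟩

/-- The two factors sharing the row index `a` sum to the inner product of columns `k' 0` and `k r`
of `U`. -/
theorem sum_psi_updateRow_updateRow' (m : MonomialIndices (q + 1) d) (r : Fin (q + 1))
    (U : Matrix.unitaryGroup (Fin d) ℂ) :
    ∑ a, ((m.updateRow' 0 a).updateRow r a).psi U =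
      if m.k r = m.k' 0 then (m.remove r).psi U else 0 := by
  have horth : ∑ a, star ((U : Matrix (Fin d) (Fin d) ℂ) a (m.k' 0)) *
      (U : Matrix (Fin d) (Fin d) ℂ) a (m.k r) = if m.k r = m.k' 0 then 1 else 0 := by
    have h : (star (U : Matrix (Fin d) (Fin d) ℂ) * U) (m.k' 0) (m.k r) =
        (1 : Matrix (Fin d) (Fin d) ℂ) (m.k' 0) (m.k r) := by
      rw [Matrix.mem_unitaryGroup_iff'.mp U.2]
    rw [Matrix.mul_apply, Matrix.one_apply] at h
    simpa [eq_comm] using h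
  have hsplit : ∀ a, ((m.updateRow' 0 a).updateRow r a).psi U =
      (star ((U : Matrix (Fin d) (Fin d) ℂ) a (m.k' 0)) *
        (U : Matrix (Fin d) (Fin d) ℂ) a (m.k r)) * (m.remove r).psi U := fun a => by
    simp only [psi, updateRow, updateRow', remove, Function.comp_apply]
    rw [Fin.prod_univ_succAbove _ r, Fin.prod_univ_succ]
    simp only [Function.update_self, Function.update_of_ne (Fin.succAbove_ne r _),
      Function.update_of_ne (Fin.succ_ne_zero _)]
    ring
  rw [Finset.sum_congr rfl fun a _ => hsplit a, ← Finset.sum_mul, horth, ite_mul, one_mul, zero_mul]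

theorem sum_expectation_updateRow_updateRow' (m : MonomialIndices (q + 1) d) (r : Fin (q + 1)) :
    ∑ a, ((m.updateRow' 0 a).updateRow r a).expectation =
      if m.k r = m.k' 0 then (m.remove r).expectation else 0 := by
  simp only [expectation]
  rw [← integral_finsetSum _ fun a _ => integrable_psi _]
  simp only [sum_psi_updateRow_updateRow']
  split_ifs <;> simp

/-- The recursion for the expectations of monomials of degree `(q + 1, q + 1)`. -/
theorem natCast_mul_expectation_add_sum_swapRow (m : MonomialIndices (q + 1) d) :
    d * m.expectation + ∑ i : Fin q, (m.swapRow i.succ).expectation =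
      ∑ r with m.j r = m.j' 0, if m.k r = m.k' 0 then (m.remove r).expectation else 0 := by
  have hinv : ∀ a, ∑ r with m.j r = m.j' 0, ((m.updateRow' 0 a).updateRow r a).expectation =
      m.expectation + ∑ i : Fin q, if m.j' i.succ = a then (m.swapRow i.succ).expectation else 0 :=
    fun a => by
    -- With `j' 0` replaced by `a`, the matrix unit at `(j' 0, a)` restores `m` from conjugated
    -- factor `0`, and produces an exchange from each other conjugated factor with row index `a`.
    have h := (m.updateRow' 0 a).sum_updateRow_eq_sum_updateRow' (m.j' 0) a
    change ∑ r with m.j r = m.j' 0, ((m.updateRow' 0 a).updateRow r a).expectation = _ at h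
    rw [h, Finset.sum_filter, Fin.sum_univ_succ]
    congr 1
    · simp [updateRow']
    · refine Finset.sum_congr rfl fun i _ => ?_
      have hi : (m.updateRow' 0 a).j' i.succ = m.j' i.succ :=
        Function.update_of_ne (Fin.succ_ne_zero i) a m.j'
      rw [hi]
      split_ifs with ha
      · subst ha
        congr 1
        simp only [updateRow', swapRow]
        congr 1
        ext s : 1
        rcases eq_or_ne s i.succ with rfl | hs
        · simp
        rcases eq_or_ne s 0 with rfl | hs0
        · simp [Function.update_of_ne hs]
        · simp [Function.update_of_ne hs, Function.update_of_ne hs0,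
            Equiv.swap_apply_of_ne_of_ne hs0 hs]
      · rfl
  -- Summing over `a` gives `d` copies of the expectation of `m` and each exchange exactly once.
  have hsum := Finset.sum_congr rfl fun a (_ : a ∈ (Finset.univ : Finset (Fin d))) => hinv a
  rw [Finset.sum_comm, Finset.sum_add_distrib] at hsum
  rw [Finset.sum_comm (s := Finset.univ) (t := Finset.univ)] at hsum
  simp only [sum_expectation_updateRow_updateRow'] at hsum
  rw [hsum]
  simp

theorem mul_norm_expectation_le (m : MonomialIndices (q + 1) d) :
    d * ‖m.expectation‖ ≤ ∑ i : Fin q, ‖(m.swapRow i.succ).expectation‖ +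
      ∑ r, if m.j r = m.j' 0 ∧ m.k r = m.k' 0 then ‖(m.remove r).expectation‖ else 0 := by
  have h : d * m.expectation = (∑ r with m.j r = m.j' 0,
      if m.k r = m.k' 0 then (m.remove r).expectation else 0) -
      ∑ i : Fin q, (m.swapRow i.succ).expectation :=
    eq_sub_of_add_eq m.natCast_mul_expectation_add_sum_swapRow
  have hd : (d : ℝ) * ‖m.expectation‖ = ‖d * m.expectation‖ := by simp
  rw [hd, h]
  refine (norm_sub_le _ _).trans ((add_comm _ _).trans_le (add_le_add (norm_sum_le _ _) ?_))
  rw [Finset.sum_filter]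
  refine (norm_sum_le _ _).trans (Finset.sum_le_sum fun r _ => ?_)
  rw [ite_and]
  split_ifs <;> simp

/-! ### The rank of the Weingarten graph -/

/-- The incidence vector of an edge between the black vertex `a` and the white vertex `b`. -/
def edgeVector (a b : Fin d) : Fin d ⊕ Fin d → ℚ :=
  Pi.single (Sum.inl a) 1 - Pi.single (Sum.inr b) 1

/-- The incidence vectors of all edges of the Weingarten graph. -/
def edgeVectors (m : MonomialIndices q d) : Set (Fin d ⊕ Fin d → ℚ) :=
  Set.range (fun r => edgeVector (m.j r) (m.k r)) ∪ Set.range fun r => edgeVector (m.j' r) (m.k' r)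

/-- The rank of the incidence matrix of the Weingarten graph. -/
noncomputable def rank (m : MonomialIndices q d) : ℕ :=
  Module.finrank ℚ (Submodule.span ℚ m.edgeVectors)

theorem left_mem_edgeVectors (m : MonomialIndices q d) (r : Fin q) :
    edgeVector (m.j r) (m.k r) ∈ m.edgeVectors := Or.inl ⟨r, rfl⟩

theorem right_mem_edgeVectors (m : MonomialIndices q d) (r : Fin q) :
    edgeVector (m.j' r) (m.k' r) ∈ m.edgeVectors := Or.inr ⟨r, rfl⟩

theorem finrank_span_le_of_subset_insert {V : Type*} [AddCommGroup V] [Module ℚ V]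
    [FiniteDimensional ℚ V] {S T : Set V} (v : V)
    (h : S ⊆ Submodule.span ℚ (insert v T)) :
    Module.finrank ℚ (Submodule.span ℚ S) ≤ Module.finrank ℚ (Submodule.span ℚ T) + 1 := by
  calc _ ≤ Module.finrank ℚ (Submodule.span ℚ (insert v T)) :=
        Submodule.finrank_mono (Submodule.span_le.mpr h)
    _ ≤ Module.finrank ℚ (Submodule.span ℚ {v}) + Module.finrank ℚ (Submodule.span ℚ T) := by
        rw [Submodule.span_insert]
        exact Submodule.finrank_add_le_finrank_add_finrank _ _
    _ ≤ _ := by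
        rw [add_comm]
        refine Nat.add_le_add_left ?_ _
        simpa using finrank_span_le_card (R := ℚ) ({v} : Set V)

theorem rank_le_two_mul (m : MonomialIndices q d) : m.rank ≤ 2 * q := by
  have h : m.edgeVectors = Set.range (Sum.elim (fun r => edgeVector (m.j r) (m.k r))
      fun r => edgeVector (m.j' r) (m.k' r)) := (Set.Sum.elim_range _ _).symm
  rw [rank, h]
  exact (finrank_range_le_card _).trans (by simp [two_mul])

/-- Adjoining the old edge of conjugated factor `0` to the new edges recovers every old edge. -/
theorem rank_le_rank_swapRow_add_one (m : MonomialIndices (q + 1) d) (i : Fin q) :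
    m.rank ≤ (m.swapRow i.succ).rank + 1 := by
  refine finrank_span_le_of_subset_insert (edgeVector (m.j' 0) (m.k' 0)) ?_
  have hsub : ∀ v ∈ (m.swapRow i.succ).edgeVectors, v ∈ Submodule.span ℚ
      (insert (edgeVector (m.j' 0) (m.k' 0)) (m.swapRow i.succ).edgeVectors) := fun v hv =>
    Submodule.subset_span (Set.mem_insert_of_mem _ hv)
  have h0 : edgeVector (m.j' 0) (m.k' 0) ∈ Submodule.span ℚ
      (insert (edgeVector (m.j' 0) (m.k' 0)) (m.swapRow i.succ).edgeVectors) :=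
    Submodule.subset_span (Set.mem_insert _ _)
  rintro _ (⟨r, rfl⟩ | ⟨r, rfl⟩)
  · exact hsub _ ((m.swapRow i.succ).left_mem_edgeVectors r)
  · have hr := hsub _ ((m.swapRow i.succ).right_mem_edgeVectors r)
    simp only [swapRow, Function.comp_apply] at hr
    by_cases hr0 : r = 0
    · subst hr0
      exact h0
    by_cases hri : r = i.succ
    · subst hri
      have hz := hsub _ ((m.swapRow i.succ).right_mem_edgeVectors 0)
      simp only [swapRow, Function.comp_apply, Equiv.swap_apply_left] at hz
      rw [Equiv.swap_apply_right] at hr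
      -- The two old and two new edges form a closed walk of length four, hence one linear relation.
      have he : edgeVector (m.j' i.succ) (m.k' i.succ) =
          edgeVector (m.j' i.succ) (m.k' 0) + edgeVector (m.j' 0) (m.k' i.succ) -
            edgeVector (m.j' 0) (m.k' 0) := by
        simp only [edgeVector]
        abel
      simp only [he]
      exact Submodule.sub_mem _ (Submodule.add_mem _ hz hr) h0
    · rwa [Equiv.swap_apply_of_ne_of_ne hr0 hri] at hr

/-- The two removed edges join the same two vertices, so they contribute a single incidence vector.
-/
theorem rank_le_rank_remove_add_one (m : MonomialIndices (q + 1) d) (r : Fin (q + 1))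
    (hj : m.j r = m.j' 0) (hk : m.k r = m.k' 0) : m.rank ≤ (m.remove r).rank + 1 := by
  refine finrank_span_le_of_subset_insert (edgeVector (m.j' 0) (m.k' 0))
    (Set.Subset.trans ?_ Submodule.subset_span)
  rintro _ (⟨s, rfl⟩ | ⟨s, rfl⟩)
  · rcases Fin.eq_self_or_eq_succAbove r s with rfl | ⟨t, rfl⟩
    · exact Or.inl (by simp only [hj, hk])
    · exact Or.inr ((m.remove r).left_mem_edgeVectors t)
  · rcases Fin.eq_zero_or_eq_succ s with rfl | ⟨t, rfl⟩
    · exact Or.inl rfl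
    · exact Or.inr ((m.remove r).right_mem_edgeVectors t)

theorem single_sub_single_mem_of_reachable (m : MonomialIndices q d) {u v : m.vertexSet}
    (h : m.weingartenGraph.underlying.Reachable u v) :
    (Pi.single u.1 1 - Pi.single v.1 1 : Fin d ⊕ Fin d → ℚ) ∈
      Submodule.span ℚ m.edgeVectors := by
  have hedge : ∀ e, (Pi.single (m.weingartenGraph.src e).1 1 -
      Pi.single (m.weingartenGraph.tgt e).1 1 : Fin d ⊕ Fin d → ℚ) ∈
      Submodule.span ℚ m.edgeVectors := by
    rintro (r | r)
    · exact Submodule.subset_span (m.left_mem_edgeVectors r)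
    · rw [← neg_sub]
      exact Submodule.neg_mem _ (Submodule.subset_span (m.right_mem_edgeVectors r))
  obtain ⟨p⟩ := h
  induction p with
  | nil => simp
  | @cons u v w hadj _ ih =>
    rw [← sub_add_sub_cancel _ (Pi.single v.1 1)]
    refine Submodule.add_mem _ ?_ ih
    rw [DiMultigraph.underlying, SimpleGraph.fromRel_adj] at hadj
    rcases hadj.2 with ⟨e, rfl, rfl⟩ | ⟨e, rfl, rfl⟩
    · exact hedge e
    · rw [← neg_sub]
      exact Submodule.neg_mem _ (hedge e)

/-- Modulo the edge vectors, each vertex equals the representative of its component, so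
representatives and edge vectors together span all the vertex basis vectors. -/
theorem numVertices_le_numComponents_add_rank (m : MonomialIndices q d) :
    m.weingartenGraph.numVertices ≤ m.weingartenGraph.numComponents + m.rank := by
  classical
  let b : m.vertexSet → Fin d ⊕ Fin d → ℚ := fun v => Pi.single v.1 1
  let c : m.weingartenGraph.underlying.ConnectedComponent → Fin d ⊕ Fin d → ℚ :=
    fun C => b C.out
  have : Fintype m.vertexSet := Fintype.ofFinite _
  have : Fintype m.weingartenGraph.underlying.ConnectedComponent := Fintype.ofFinite _
  have hb : LinearIndependent ℚ b :=
    (Pi.linearIndependent_single_one (Fin d ⊕ Fin d) ℚ).comp _ Subtype.val_injective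
  have hspan : Submodule.span ℚ (Set.range b) ≤
      Submodule.span ℚ (Set.range c) ⊔ Submodule.span ℚ m.edgeVectors := by
    rw [Submodule.span_le]
    rintro _ ⟨v, rfl⟩
    let w := (m.weingartenGraph.underlying.connectedComponentMk v).out
    have hw : m.weingartenGraph.underlying.Reachable v w :=
      (SimpleGraph.ConnectedComponent.exact (Quot.out_eq _)).symm
    rw [SetLike.mem_coe, ← add_sub_cancel (b w) (b v)]
    exact Submodule.add_mem_sup (Submodule.subset_span ⟨_, rfl⟩)
      (m.single_sub_single_mem_of_reachable hw)
  calc m.weingartenGraph.numVertices = Module.finrank ℚ (Submodule.span ℚ (Set.range b)) := by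
        rw [finrank_span_eq_card hb, DiMultigraph.numVertices, Nat.card_eq_fintype_card]
    _ ≤ Module.finrank ℚ (Submodule.span ℚ (Set.range c)) + m.rank :=
        (Submodule.finrank_mono hspan).trans (Submodule.finrank_add_le_finrank_add_finrank _ _)
    _ ≤ m.weingartenGraph.numComponents + m.rank := by
        rw [DiMultigraph.numComponents, Nat.card_eq_fintype_card]
        exact Nat.add_le_add_right (finrank_range_le_card c) _

/-! ### The bounds -/

instance : Finite (MonomialIndices q d) :=
  Finite.of_injective
    (fun m : MonomialIndices q d => (m.j, m.k, m.j', m.k')) fun m n h => by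
      cases m
      cases n
      simp_all

theorem norm_expectation_le_of_forall (hd : 2 * (q + 1) ≤ d) {C : ℝ}
    (hC : ∀ m : MonomialIndices q d, ‖m.expectation‖ * d ^ q ≤ C)
    (m : MonomialIndices (q + 1) d) : ‖m.expectation‖ * d ^ (q + 1) ≤ 2 * (q + 1) * C := by
  have hd' : 2 * ((q : ℝ) + 1) ≤ d := by exact_mod_cast hd
  have hq : (0 : ℝ) ≤ q := q.cast_nonneg
  have : Nonempty (MonomialIndices (q + 1) d) := ⟨m⟩
  obtain ⟨n, hn⟩ := Finite.exists_max fun m : MonomialIndices (q + 1) d => ‖m.expectation‖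
  have hC0 : 0 ≤ C := le_trans (by positivity) (hC (m.remove 0))
  refine (mul_le_mul_of_nonneg_right (hn m) (by positivity)).trans ?_
  have h1 : ∑ i : Fin q, ‖(n.swapRow i.succ).expectation‖ ≤ q * ‖n.expectation‖ := by
    simpa using Finset.sum_le_card_nsmul Finset.univ _ _ fun i (_ : i ∈ Finset.univ) =>
      hn (n.swapRow (Fin.succ i))
  have h2 : (∑ r, if n.j r = n.j' 0 ∧ n.k r = n.k' 0 then ‖(n.remove r).expectation‖ else 0) *
      (d : ℝ) ^ q ≤ (q + 1) * C := by
    rw [Finset.sum_mul]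
    refine (Finset.sum_le_card_nsmul _ _ C fun r _ => ?_).trans (by simp)
    split_ifs
    · exact hC _
    · simpa using hC0
  have h := mul_le_mul_of_nonneg_right n.mul_norm_expectation_le
    (show (0 : ℝ) ≤ (d : ℝ) ^ q by positivity)
  have h3 := mul_le_mul_of_nonneg_right h1 (show (0 : ℝ) ≤ (d : ℝ) ^ q by positivity)
  -- As `q ≤ d / 2`, the exchanged terms cost at most half of the left side; this is the origin of
  -- the factor 2 in the bound.
  have h4 : (2 * q) * (‖n.expectation‖ * (d : ℝ) ^ q) ≤ d * (‖n.expectation‖ * (d : ℝ) ^ q) :=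
    mul_le_mul_of_nonneg_right (by linarith) (by positivity)
  rw [pow_succ]
  linarith [add_mul (∑ i : Fin q, ‖(n.swapRow i.succ).expectation‖)
    (∑ r, if n.j r = n.j' 0 ∧ n.k r = n.k' 0 then ‖(n.remove r).expectation‖ else 0)
    ((d : ℝ) ^ q)]

theorem norm_expectation_mul_pow_rank_le_of_forall (hd : 2 * (q + 1) ≤ d) {C : ℝ}
    (hC : ∀ m : MonomialIndices q d, ‖m.expectation‖ * d ^ m.rank ≤ C)
    (m : MonomialIndices (q + 1) d) :
    ‖m.expectation‖ * (d / (2 * (q + 1))) ^ m.rank ≤ C := by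
  have hd' : 2 * ((q : ℝ) + 1) ≤ d := by exact_mod_cast hd
  have hq : (0 : ℝ) ≤ q := q.cast_nonneg
  -- With this weight `d = 2 * (q + 1) * D`: the loss of `D` per unit of rank cancels, and the
  -- numerical factor beats the `q` exchanges. `1 ≤ D` lets rank inequalities pass to powers.
  set D : ℝ := d / (2 * (q + 1)) with hD
  have hDd : (d : ℝ) = 2 * (q + 1) * D := by rw [hD]; field_simp
  have hD1 : 1 ≤ D := by rw [hD, le_div_iff₀ (by positivity)]; linarith
  have hDle : D ≤ d := by rw [hDd]; nlinarith
  have : Nonempty (MonomialIndices (q + 1) d) := ⟨m⟩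
  obtain ⟨n, hn⟩ := Finite.exists_max fun m : MonomialIndices (q + 1) d =>
    ‖m.expectation‖ * D ^ m.rank
  refine (hn m).trans ?_
  have hC0 : 0 ≤ C := le_trans (by positivity) (hC (m.remove 0))
  set M := ‖n.expectation‖ * D ^ n.rank with hM
  have h1 : (∑ i : Fin q, ‖(n.swapRow i.succ).expectation‖) * D ^ n.rank ≤ q * (M * D) := by
    rw [Finset.sum_mul]
    refine (Finset.sum_le_card_nsmul _ _ (M * D) fun i _ => ?_).trans (by simp)
    calc _ ≤ ‖(n.swapRow i.succ).expectation‖ * D ^ ((n.swapRow i.succ).rank + 1) := by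
          gcongr
          exact n.rank_le_rank_swapRow_add_one i
      _ = ‖(n.swapRow i.succ).expectation‖ * D ^ (n.swapRow i.succ).rank * D := by ring
      _ ≤ M * D := mul_le_mul_of_nonneg_right (hn _) (by positivity)
  have h2 : (∑ r, if n.j r = n.j' 0 ∧ n.k r = n.k' 0 then ‖(n.remove r).expectation‖ else 0) *
      D ^ n.rank ≤ (q + 1) * (C * D) := by
    rw [Finset.sum_mul]
    refine (Finset.sum_le_card_nsmul _ _ (C * D) fun r _ => ?_).trans (by simp)
    split_ifs with hr
    · calc _ ≤ ‖(n.remove r).expectation‖ * D ^ ((n.remove r).rank + 1) := by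
            gcongr
            exact n.rank_le_rank_remove_add_one r hr.1 hr.2
        _ = ‖(n.remove r).expectation‖ * D ^ (n.remove r).rank * D := by ring
        _ ≤ ‖(n.remove r).expectation‖ * (d : ℝ) ^ (n.remove r).rank * D := by gcongr
        _ ≤ C * D := mul_le_mul_of_nonneg_right (hC _) (by positivity)
    · rw [zero_mul]
      positivity
  have h := mul_le_mul_of_nonneg_right n.mul_norm_expectation_le
    (show 0 ≤ D ^ n.rank by positivity)
  rw [add_mul, mul_assoc, ← hM] at h
  have h3 : (2 * (q + 1) * M) * D ≤ (q * M + (q + 1) * C) * D := by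
    calc (2 * (q + 1) * M) * D = d * M := by rw [hDd]; ring
      _ ≤ q * (M * D) + (q + 1) * (C * D) := h.trans (add_le_add h1 h2)
      _ = _ := by ring
  -- After cancelling `D` this says `(q + 2) * M ≤ (q + 1) * C`, hence `M ≤ C`.
  have h4 := le_of_mul_le_mul_right h3 (by linarith)
  have hM0 : 0 ≤ M := by positivity
  nlinarith

theorem exists_norm_expectation_le (q : ℕ) : ∃ C : ℝ, ∀ d : ℕ, ∀ m : MonomialIndices q d,
    ‖m.expectation‖ * d ^ q ≤ C ∧ ‖m.expectation‖ * d ^ m.rank ≤ C := by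
  induction q with
  | zero =>
    refine ⟨1, fun d m => ?_⟩
    have hrank : m.rank = 0 := Nat.le_zero.mp m.rank_le_two_mul
    simpa [hrank] using m.norm_expectation_le_one
  | succ q ih =>
    obtain ⟨C, hC⟩ := ih
    have hC0 : 0 ≤ C := by
      refine le_trans ?_ (hC 1 ⟨0, 0, 0, 0⟩).1
      positivity
    set B : ℝ := 2 * (q + 1) with hB
    have hB1 : 1 ≤ B := by rw [hB]; linarith [q.cast_nonneg (α := ℝ)]
    have hBC : 0 ≤ B * C := by positivity
    -- `B * C` serves the first bound for large `d`, `B ^ (2 * (q + 1)) * C` the rank bound (rank is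
    -- at most the number of edges), and the extra `1` the trivial bound when `d < B`.
    refine ⟨B * C + B ^ (2 * (q + 1)) * (C + 1), fun d m => ?_⟩
    have hBpow : ∀ n ≤ 2 * (q + 1), B ^ n ≤ B ^ (2 * (q + 1)) := fun n hn =>
      pow_le_pow_right₀ hB1 hn
    rcases le_or_gt (2 * (q + 1)) d with hd | hd
    · constructor
      · refine (norm_expectation_le_of_forall hd (fun m => (hC d m).1) m).trans ?_
        exact le_add_of_nonneg_right (by positivity)
      · have h := norm_expectation_mul_pow_rank_le_of_forall hd (fun m => (hC d m).2) m
        rw [← hB, div_pow, mul_div_assoc', div_le_iff₀ (by positivity)] at h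
        refine h.trans ?_
        have h1 := mul_le_mul_of_nonneg_left (hBpow _ m.rank_le_two_mul) hC0
        have h2 : 0 ≤ B ^ (2 * (q + 1)) := by positivity
        linarith
    · have hdB : (d : ℝ) ≤ B := by rw [hB]; exact_mod_cast hd.le
      have key : ∀ n ≤ 2 * (q + 1), ‖m.expectation‖ * d ^ n ≤
          B * C + B ^ (2 * (q + 1)) * (C + 1) := fun n hn => by
        calc ‖m.expectation‖ * d ^ n ≤ 1 * B ^ (2 * (q + 1)) :=
              mul_le_mul m.norm_expectation_le_one
                ((pow_le_pow_left₀ (by positivity) hdB n).trans (hBpow n hn)) (by positivity)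
                zero_le_one
          _ ≤ _ := by
              have : 0 ≤ B ^ (2 * (q + 1)) * C := by positivity
              linarith
      exact ⟨key _ (by omega), key _ m.rank_le_two_mul⟩

end MonomialIndices

theorem proposition3p2 (q : ℕ) (hq : 1 ≤ q) :
    ∃ C : ℝ, ∀ d : ℕ, 1 ≤ d → ∀ m : MonomialIndices q d,
      ‖m.expectation‖ ≤ C * (d : ℝ) ^ (-(q : ℤ)) ∧
      ‖m.expectation‖ ≤ C * (d : ℝ) ^
        ((m.weingartenGraph.numComponents : ℤ) - (m.weingartenGraph.numVertices : ℤ)) := by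
  obtain ⟨C, hC⟩ := MonomialIndices.exists_norm_expectation_le q
  refine ⟨C, fun d hd m => ?_⟩
  have hd1 : (1 : ℝ) ≤ d := by exact_mod_cast hd
  have hd0 : (0 : ℝ) < d := by linarith
  have hC0 : 0 ≤ C := le_trans (by positivity) (hC d m).1
  constructor
  · rw [zpow_neg, zpow_natCast, ← div_eq_mul_inv, le_div_iff₀ (by positivity)]
    exact (hC d m).1
  · have h : ‖m.expectation‖ ≤ C * (d : ℝ) ^ (-(m.rank : ℤ)) := by
      rw [zpow_neg, zpow_natCast, ← div_eq_mul_inv, le_div_iff₀ (by positivity)]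
      exact (hC d m).2
    refine h.trans (mul_le_mul_of_nonneg_left (zpow_le_zpow_right₀ hd1 ?_) hC0)
    have := m.numVertices_le_numComponents_add_rank
    omega
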